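/- A metric space $(X,d)$ is \emph{uniformly discrete} if there is $\delta>0$ with $d(x,y)\ge\delta$ for all $x\ne y$; it has \emph{bounded geometry} if for every $r>0$ there is $N\in\mathbb N$ such that every closed ball of radius $r$ has at most $N$ points; and it has \emph{property A} if for all $\varepsilon>0$ and $R>0$ there are $S>0$ and finite nonempty sets $A_x\subseteq X\times\mathbb N$ $(x\in X)$ such that (a) $(y,j)\in A_x$ implies $d(x,y)<S$, and (b) $|A_x\,\triangle\,A_y|/|A_x|<\varepsilon$ whenever $d(x,y)<R$. A countable discrete group has property A if it has property A as a metric space for a left-invariant metric in which all balls are finite (this does not depend on the choice of such a metric). An action of a group $G$ on $X$ is \emph{cocompact} if there is a compact $K\subseteq X$ with $\bigcup_{g\in G} gK=X$. \textbf{Corollary.} Let $G$ be a finitely generated group acting cocompactly by isometries on a uniformly discrete metric space $X$ of bounded geometry, and suppose that $X$ has property A. If there is a point $x_0\in X$ whose stabilizer in $G$ has property A, then $G$ has property A. -/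

import Mathlib

namespace CoarseGeometry

/-- Distinct points of `X` are at distance bounded below by a positive constant. -/
def IsUniformlyDiscrete (X : Type*) [MetricSpace X] : Prop :=
  ∃ δ : ℝ, 0 < δ ∧ ∀ x y : X, x ≠ y → δ ≤ dist x y

/-- For every radius there is a uniform finite bound on the number of points in balls of that
radius. -/
def HasBoundedGeometry (X : Type*) [MetricSpace X] : Prop :=
  ∀ r : ℝ, 0 < r → ∃ N : ℕ, ∀ x : X, (Metric.closedBall x r).encard ≤ N

open scoped Classical in
/-- Yu's property A: for all `R, ε > 0` there are `S > 0` and finite nonempty sets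
`A x ⊆ X × ℕ`, indexed by `x : X`, such that `A x ⊆ B(x, S) × ℕ` and
`|A x ∆ A y| / |A x| < ε` whenever `dist x y < R`. -/
def HasPropertyA (X : Type*) [MetricSpace X] : Prop :=
  ∀ ε : ℝ, 0 < ε → ∀ R : ℝ, 0 < R →
    ∃ S : ℝ, 0 < S ∧ ∃ A : X → Finset (X × ℕ),
      (∀ x, (A x).Nonempty) ∧
      (∀ x, ∀ p ∈ A x, dist x p.1 < S) ∧
      (∀ x y, dist x y < R →
        ((symmDiff (A x) (A y)).card : ℝ) / ((A x).card : ℝ) < ε)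

/-- The metric `m` on the discrete group `G` is invariant under left translations and proper
(balls are finite). -/
structure IsProperLeftInvariant {G : Type*} [Group G] (m : MetricSpace G) : Prop where
  dist_mul_left : ∀ g a b : G, m.dist (g * a) (g * b) = m.dist a b
  finite_ball : ∀ r : ℝ, {g : G | m.dist 1 g ≤ r}.Finite

/-- A (countable, discrete) group has property A if it has property A as a metric space, for a
proper left-invariant metric. By `hasPropertyA_of_isProperLeftInvariant` below, the choice of this
metric does not matter. -/
def GroupHasPropertyA (G : Type*) [Group G] : Prop :=
  ∃ m : MetricSpace G, IsProperLeftInvariant m ∧ @HasPropertyA G m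

/-- The action of `G` on `X` is cocompact: the translates of some compact set cover `X`. -/
def IsCocompactAction (G X : Type*) [Group G] [MetricSpace X] [MulAction G X] : Prop :=
  ∃ K : Set X, IsCompact K ∧ ∀ x : X, ∃ g : G, ∃ k ∈ K, g • k = x

theorem hasPropertyA_of_isProperLeftInvariant {G : Type*} [Group G] (m₁ m₂ : MetricSpace G)
    (h₁ : IsProperLeftInvariant m₁) (h₂ : IsProperLeftInvariant m₂)
    (h : @HasPropertyA G m₁) : @HasPropertyA G m₂ := by
  have key : ∀ m n : MetricSpace G, IsProperLeftInvariant m → IsProperLeftInvariant n →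
      ∀ r : ℝ, ∃ s : ℝ, 0 < s ∧ ∀ x y : G, m.dist x y < r → n.dist x y < s := by
    intro m n hm hn r
    obtain ⟨b, hb⟩ := ((hm.finite_ball r).image fun g => n.dist 1 g).bddAbove
    refine ⟨max b 0 + 1, by positivity, fun x y hxy => ?_⟩
    have e₁ := hm.dist_mul_left x⁻¹ x y
    have e₂ := hn.dist_mul_left x⁻¹ x y
    rw [inv_mul_cancel] at e₁ e₂
    have hle : n.dist 1 (x⁻¹ * y) ≤ b :=
      hb ⟨x⁻¹ * y, by simp only [Set.mem_ofPred_eq]; linarith, rfl⟩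
    have := le_max_left b 0
    linarith
  intro ε hε R _
  obtain ⟨R', hR', hRR⟩ := key m₂ m₁ h₂ h₁ R
  obtain ⟨S', _, A, hne, hsupp, hvar⟩ := h ε hε R' hR'
  obtain ⟨S, hS, hSS⟩ := key m₁ m₂ h₁ h₂ S'
  exact ⟨S, hS, A, hne, fun x p hp => hSS _ _ (hsupp x p hp),
    fun x y hxy => hvar x y (hRR _ _ hxy)⟩

end CoarseGeometry

/-! Write `H` for the stabilizer of `x₀`. Property A of `X` gives each `g` a finite set `A (g • x₀)`
of labelled points near `g • x₀`. By cocompactness each such point `z` lies near some `s z • x₀`,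
hence names a coset `s z * H` passing within a uniform distance of `g`. Over `z` one places a
translate to that coset of a set witnessing property A of `H`, based at a point of the coset close
to `g`. Moving `g` slightly changes few points `z`, and changes little over each one that remains.

For this count the sets of `H` must share one cardinality `n`, so that mass is the product `|A| *
n`; `HasPropertyA.exists_card_eq` provides this by rounding, and `card_symmDiff_sigma_le` does the
count. -/

namespace CoarseGeometry

open scoped Pointwise

/-! ### Word metrics and bounded geometry -/

/-- A finitely generated group carries a proper left-invariant metric, the word metric. -/
theorem exists_isProperLeftInvariant (G : Type*) [Group G] [Group.FG G] :
    ∃ m : MetricSpace G, IsProperLeftInvariant m := by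
  classical
  obtain ⟨S, hS, hfin⟩ := Group.fg_iff.1 ‹Group.FG G›
  -- Adjoining `1` makes the powers of `T` increase, so `T ^ n` is the whole word ball of radius
  -- `n`.
  set T : Set G := insert 1 (S ∪ S⁻¹) with hT
  have hTfin : T.Finite := (hfin.union hfin.inv).insert 1
  have hTone : (1 : G) ∈ T := Set.mem_insert _ _
  have hTinv : T⁻¹ = T := by
    rw [hT, Set.inv_insert, Set.union_inv, inv_inv, inv_one, Set.union_comm]
  have hex : ∀ g : G, ∃ n : ℕ, g ∈ T ^ n := by
    intro g
    have hg : g ∈ Subgroup.closure S := hS ▸ Subgroup.mem_top g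
    induction hg using Subgroup.closure_induction with
    | mem x hx => exact ⟨1, by rw [pow_one]; exact Or.inr (Or.inl hx)⟩
    | one => exact ⟨0, by simp⟩
    | mul x y _ _ hx hy =>
      obtain ⟨a, ha⟩ := hx
      obtain ⟨b, hb⟩ := hy
      exact ⟨a + b, by rw [pow_add]; exact Set.mul_mem_mul ha hb⟩
    | inv x _ hx =>
      obtain ⟨a, ha⟩ := hx
      exact ⟨a, by rw [← hTinv, inv_pow]; simpa using ha⟩
  let l : G → ℕ := fun g => Nat.find (hex g)
  have l_mem : ∀ g, g ∈ T ^ l g := fun g => Nat.find_spec (hex g)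
  have l_le : ∀ {g n}, g ∈ T ^ n → l g ≤ n := fun h => Nat.find_min' (hex _) h
  have l_one : l 1 = 0 := Nat.le_zero.1 (l_le (by simp))
  have l_mul : ∀ a b, l (a * b) ≤ l a + l b := fun a b =>
    l_le (by rw [pow_add]; exact Set.mul_mem_mul (l_mem a) (l_mem b))
  have l_inv_le : ∀ a, l a⁻¹ ≤ l a := fun a =>
    l_le (by rw [← hTinv, inv_pow]; simpa using l_mem a)
  have l_inv : ∀ a, l a⁻¹ = l a := fun a =>
    le_antisymm (l_inv_le a) (by simpa using l_inv_le a⁻¹)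
  have l_eq : ∀ a, l a = 0 → a = 1 := fun a ha => by
    have := l_mem a
    rw [ha, pow_zero] at this
    exact this
  let m : MetricSpace G :=
    { dist := fun a b => (l (a⁻¹ * b) : ℝ)
      dist_self := fun a => by simp [l_one]
      dist_comm := fun a b => by rw [← l_inv (a⁻¹ * b)]; simp
      dist_triangle := fun a b c => by
        have := l_mul (a⁻¹ * b) (b⁻¹ * c)
        rw [mul_assoc, mul_inv_cancel_left] at this
        exact_mod_cast this
      eq_of_dist_eq_zero := fun {a b} h =>
        inv_mul_eq_one.1 (l_eq _ (by exact_mod_cast h)) }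
  refine ⟨m, fun g a b => ?_, fun r => ?_⟩
  · change (l ((g * a)⁻¹ * (g * b)) : ℝ) = l (a⁻¹ * b)
    congr 2
    group
  · have hpow : ∀ n : ℕ, (T ^ n).Finite := fun n => by
      induction n with
      | zero => simp
      | succ n ih => rw [pow_succ]; exact ih.mul hTfin
    refine (hpow ⌊r⌋₊).subset fun g hg => ?_
    have hg' : (l (1⁻¹ * g) : ℝ) ≤ r := hg
    rw [inv_one, one_mul] at hg'
    exact Set.pow_subset_pow_right hTone (Nat.le_floor hg') (l_mem g)

theorem IsProperLeftInvariant.hasBoundedGeometry {G : Type*} [Group G] {m : MetricSpace G}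
    (hm : IsProperLeftInvariant m) : HasBoundedGeometry G := by
  intro r _
  refine ⟨(hm.finite_ball r).toFinset.card, fun x => ?_⟩
  rw [← Set.encard_coe_eq_coe_finsetCard, Set.Finite.coe_toFinset,
    ← (mul_right_injective x).encard_image {g : G | m.dist 1 g ≤ r}]
  refine Set.encard_le_encard fun y hy => ⟨x⁻¹ * y, ?_, mul_inv_cancel_left x y⟩
  have h := hm.dist_mul_left x⁻¹ x y
  rw [inv_mul_cancel] at h
  rw [Metric.mem_closedBall, dist_comm] at hy
  exact h.le.trans hy

theorem HasBoundedGeometry.finite_closedBall {X : Type*} [MetricSpace X]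
    (h : HasBoundedGeometry X) (x : X) (r : ℝ) : (Metric.closedBall x r).Finite := by
  obtain ⟨N, hN⟩ := h (max r 1) (by positivity)
  exact (Set.finite_of_encard_le_coe (hN x)).subset
    (Metric.closedBall_subset_closedBall (le_max_left _ _))

theorem HasBoundedGeometry.countable {X : Type*} [MetricSpace X]
    (h : HasBoundedGeometry X) (x : X) : Countable X := by
  rw [← Set.countable_univ_iff, ← Metric.iUnion_closedBall_nat x]
  exact Set.countable_iUnion fun n => (h.finite_closedBall x n).countable

/-! ### Witnesses of property A with equal cardinality -/

section Normalize

open scoped Classical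

variable {X : Type*}

/-- The number of points of `A` above `k`. -/
noncomputable def fiberCard (A : Finset (X × ℕ)) (k : X) : ℕ := {p ∈ A | p.1 = k}.card

/-- `A` rescaled to total mass about `n`, rounding down above each point. -/
noncomputable def rescale (n : ℕ) (A : Finset (X × ℕ)) : Finset (X × ℕ) :=
  {p ∈ A.image Prod.fst ×ˢ Finset.range n | p.2 < n * fiberCard A p.1 / A.card}

/-- `A` rescaled to total mass exactly `n`, the rounding error being put above `x`. -/
noncomputable def normalize (n : ℕ) (x : X) (A : Finset (X × ℕ)) : Finset (X × ℕ) :=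
  rescale n A ∪ {x} ×ˢ Finset.Ico n (n + (n - (rescale n A).card))

theorem fiberCard_le (A : Finset (X × ℕ)) (k : X) : fiberCard A k ≤ A.card :=
  Finset.card_filter_le _ _

theorem sum_fiberCard (A : Finset (X × ℕ)) {T : Finset X} (hT : A.image Prod.fst ⊆ T) :
    ∑ k ∈ T, fiberCard A k = A.card :=
  (Finset.card_eq_sum_card_fiberwise fun _ hp => hT (Finset.mem_image_of_mem _ hp)).symm

theorem mem_rescale {n : ℕ} {A : Finset (X × ℕ)} {p : X × ℕ} :
    p ∈ rescale n A ↔ p.2 < n * fiberCard A p.1 / A.card := by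
  rw [rescale, Finset.mem_filter, and_iff_right_iff_imp]
  intro h
  have hpos : 0 < fiberCard A p.1 := by
    by_contra! h0
    simp [Nat.le_zero.1 h0] at h
  obtain ⟨q, hq⟩ := Finset.card_pos.1 hpos
  rw [Finset.mem_filter] at hq
  refine Finset.mem_product.2 ⟨Finset.mem_image.2 ⟨q, hq⟩, Finset.mem_range.2 (h.trans_le ?_)⟩
  exact Nat.div_le_of_le_mul (by
    rw [mul_comm A.card]; exact Nat.mul_le_mul_left _ (fiberCard_le _ _))

theorem fst_mem_of_mem_rescale {n : ℕ} {A : Finset (X × ℕ)} {p : X × ℕ} (h : p ∈ rescale n A) :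
    p.1 ∈ A.image Prod.fst :=
  (Finset.mem_product.1 (Finset.mem_filter.1 h).1).1

theorem fiberCard_rescale (n : ℕ) (A : Finset (X × ℕ)) (k : X) :
    fiberCard (rescale n A) k = n * fiberCard A k / A.card := by
  have : {p ∈ rescale n A | p.1 = k} =
      {k} ×ˢ Finset.range (n * fiberCard A k / A.card) := by
    ext ⟨a, j⟩
    simp only [Finset.mem_filter, mem_rescale, Finset.mem_product, Finset.mem_singleton,
      Finset.mem_range]
    constructor
    · rintro ⟨h, rfl⟩
      exact ⟨rfl, h⟩
    · rintro ⟨rfl, h⟩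
      exact ⟨h, rfl⟩
  rw [fiberCard, this, Finset.card_product]
  simp

theorem card_rescale (n : ℕ) (A : Finset (X × ℕ)) :
    (rescale n A).card = ∑ k ∈ A.image Prod.fst, n * fiberCard A k / A.card := by
  rw [← sum_fiberCard (rescale n A) (T := A.image Prod.fst)
    (Finset.image_subset_iff.2 fun _ => fst_mem_of_mem_rescale)]
  exact Finset.sum_congr rfl fun k _ => fiberCard_rescale n A k

theorem card_rescale_le (n : ℕ) (A : Finset (X × ℕ)) : (rescale n A).card ≤ n := by
  rw [card_rescale]
  rcases A.card.eq_zero_or_pos with h | h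
  · simp [h]
  refine Nat.le_of_mul_le_mul_left ?_ h
  calc A.card * ∑ k ∈ A.image Prod.fst, n * fiberCard A k / A.card
      ≤ ∑ k ∈ A.image Prod.fst, n * fiberCard A k := by
        rw [Finset.mul_sum]
        exact Finset.sum_le_sum fun k _ => Nat.mul_div_le _ _
    _ = A.card * n := by rw [← Finset.mul_sum, sum_fiberCard A subset_rfl, mul_comm]

/-- Rounding down loses less than one point above each base point. -/
theorem le_card_rescale (n : ℕ) {A : Finset (X × ℕ)} (hA : A.Nonempty) :
    n ≤ (rescale n A).card + (A.image Prod.fst).card := by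
  have hpos : 0 < A.card := hA.card_pos
  refine Nat.le_of_mul_le_mul_left ?_ hpos
  calc A.card * n = ∑ k ∈ A.image Prod.fst, n * fiberCard A k := by
        rw [← Finset.mul_sum, sum_fiberCard A subset_rfl, mul_comm]
    _ ≤ ∑ k ∈ A.image Prod.fst, A.card * (n * fiberCard A k / A.card + 1) :=
        Finset.sum_le_sum fun k _ => (Nat.lt_mul_div_succ _ hpos).le
    _ = _ := by rw [← Finset.mul_sum, Finset.sum_add_distrib, card_rescale]; simp

theorem card_normalize (n : ℕ) (x : X) (A : Finset (X × ℕ)) : (normalize n x A).card = n := by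
  have := card_rescale_le n A
  rw [normalize, Finset.card_union_of_disjoint, Finset.card_product]
  · simp only [Finset.card_singleton, Nat.card_Ico]
    omega
  -- Rescaled points have height below `n`, the added ones height at least `n`.
  · rw [Finset.disjoint_left]
    intro p hp hp'
    have h1 := (Finset.mem_product.1 (Finset.mem_filter.1 hp).1).2
    have h2 := (Finset.mem_product.1 hp').2
    rw [Finset.mem_range] at h1
    rw [Finset.mem_Ico] at h2
    omega

theorem abs_sub_natDiv_le (a b c d : ℕ) :
    |((a / b : ℕ) : ℝ) - ((c / d : ℕ) : ℝ)| ≤ |(a : ℝ) / b - (c : ℝ) / d| + 1 := by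
  have h1 := Nat.floor_div_eq_div (K := ℝ) a b
  have h2 := Nat.floor_div_eq_div (K := ℝ) c d
  rw [← h1, ← h2]
  have a1 := Nat.floor_le (show (0 : ℝ) ≤ (a : ℝ) / b by positivity)
  have a2 := Nat.floor_le (show (0 : ℝ) ≤ (c : ℝ) / d by positivity)
  have b1 := Nat.lt_floor_add_one ((a : ℝ) / b)
  have b2 := Nat.lt_floor_add_one ((c : ℝ) / d)
  rw [abs_le]
  constructor
  · linarith [neg_abs_le ((a : ℝ) / b - (c : ℝ) / d)]
  · linarith [le_abs_self ((a : ℝ) / b - (c : ℝ) / d)]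

theorem card_symmDiff_range (a b : ℕ) :
    ((symmDiff (Finset.range a) (Finset.range b)).card : ℝ) = |(a : ℝ) - b| := by
  wlog h : a ≤ b generalizing a b
  · rw [symmDiff_comm, this b a (le_of_not_ge h), abs_sub_comm]
  have : symmDiff (Finset.range a) (Finset.range b) = Finset.Ico a b := by
    ext k
    simp only [Finset.mem_symmDiff, Finset.mem_range, Finset.mem_Ico]
    omega
  rw [this, Nat.card_Ico, Nat.cast_sub h, abs_sub_comm, abs_of_nonneg]
  exact sub_nonneg.2 (by exact_mod_cast h)

theorem abs_card_sub_card_le {α : Type*} [DecidableEq α] (s t : Finset α) :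
    |(s.card : ℝ) - t.card| ≤ (symmDiff s t).card := by
  have key : ∀ u v : Finset α, (u.card : ℝ) ≤ v.card + (symmDiff u v).card := fun u v => by
    have : u ⊆ v ∪ symmDiff u v := fun p hp => by
      by_cases hv : p ∈ v <;> simp [Finset.mem_symmDiff, hp, hv]
    exact_mod_cast (Finset.card_le_card this).trans (Finset.card_union_le _ _)
  rw [abs_le]
  have h1 := key s t
  have h2 := key t s
  rw [symmDiff_comm] at h2
  constructor <;> linarith

theorem abs_fiberCard_sub_le (A B : Finset (X × ℕ)) (k : X) :
    |(fiberCard A k : ℝ) - fiberCard B k| ≤ fiberCard (symmDiff A B) k := by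
  refine (abs_card_sub_card_le _ _).trans (le_of_eq ?_)
  rw [fiberCard]
  congr 2
  ext p
  simp only [Finset.mem_symmDiff, Finset.mem_filter]
  tauto

/-- Fibres of rescaled sets are initial segments of `ℕ`, hence nested, so their symmetric difference
has the least possible size. -/
theorem fiberCard_symmDiff_rescale (n : ℕ) (A B : Finset (X × ℕ)) (k : X) :
    (fiberCard (symmDiff (rescale n A) (rescale n B)) k : ℝ) =
      |((n * fiberCard A k / A.card : ℕ) : ℝ) - ((n * fiberCard B k / B.card : ℕ) : ℝ)| := by
  rw [← card_symmDiff_range]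
  have : {p ∈ symmDiff (rescale n A) (rescale n B) | p.1 = k} =
      {k} ×ˢ symmDiff (Finset.range (n * fiberCard A k / A.card))
        (Finset.range (n * fiberCard B k / B.card)) := by
    ext ⟨a, j⟩
    simp only [Finset.mem_filter, Finset.mem_symmDiff, mem_rescale, Finset.mem_product,
      Finset.mem_singleton, Finset.mem_range]
    constructor
    · rintro ⟨h, rfl⟩
      exact ⟨rfl, h⟩
    · rintro ⟨rfl, h⟩
      exact ⟨h, rfl⟩
  rw [fiberCard, this, Finset.card_product]
  simp

/-- One `n * |A ∆ B| / |A|` comes from comparing fibres, the other from comparing the total masses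
`|A|` and `|B|`; rounding costs at most one per base point. -/
theorem card_symmDiff_rescale_le (n : ℕ) {A B : Finset (X × ℕ)} (hA : A.Nonempty)
    (hB : B.Nonempty) :
    ((symmDiff (rescale n A) (rescale n B)).card : ℝ) ≤
      2 * n * ((symmDiff A B).card / A.card) +
        ((A.image Prod.fst).card + (B.image Prod.fst).card) := by
  set T := A.image Prod.fst ∪ B.image Prod.fst with hT
  have ha : (0 : ℝ) < A.card := by exact_mod_cast hA.card_pos
  have hb : (0 : ℝ) < B.card := by exact_mod_cast hB.card_pos
  have hAT : A.image Prod.fst ⊆ T := Finset.subset_union_left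
  have hBT : B.image Prod.fst ⊆ T := Finset.subset_union_right
  have hDT : (symmDiff A B).image Prod.fst ⊆ T := by
    rw [hT, ← Finset.image_union]
    exact Finset.image_subset_image Finset.symmDiff_subset_union
  have hRT : (symmDiff (rescale n A) (rescale n B)).image Prod.fst ⊆ T := by
    refine Finset.image_subset_iff.2 fun p hp => ?_
    rcases Finset.mem_symmDiff.1 hp with h | h
    · exact hAT (fst_mem_of_mem_rescale h.1)
    · exact hBT (fst_mem_of_mem_rescale h.1)
  have hTcard : (T.card : ℝ) ≤ (A.image Prod.fst).card + (B.image Prod.fst).card := by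
    exact_mod_cast Finset.card_union_le _ _
  have hterm : ∀ k, |((n * fiberCard A k : ℕ) : ℝ) / A.card
      - ((n * fiberCard B k : ℕ) : ℝ) / B.card| ≤
      n * (fiberCard (symmDiff A B) k / A.card)
        + n * ((symmDiff A B).card / A.card) * (fiberCard B k / B.card) := by
    intro k
    have e : ((n * fiberCard A k : ℕ) : ℝ) / A.card - ((n * fiberCard B k : ℕ) : ℝ) / B.card =
        n * (((fiberCard A k : ℝ) - fiberCard B k) / A.card)
        + n * (((B.card : ℝ) - A.card) / A.card) * (fiberCard B k / B.card) := by
      push_cast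
      field_simp
      ring
    rw [e]
    refine (abs_add_le _ _).trans ?_
    simp only [abs_mul, abs_div, Nat.abs_cast]
    have h1 := abs_fiberCard_sub_le A B k
    have h2 := abs_card_sub_card_le A B
    rw [abs_sub_comm] at h2
    have h3 : (0 : ℝ) ≤ fiberCard B k / B.card := by positivity
    exact add_le_add
      (mul_le_mul_of_nonneg_left (div_le_div_of_nonneg_right h1 ha.le) n.cast_nonneg)
      (mul_le_mul_of_nonneg_right
        (mul_le_mul_of_nonneg_left (div_le_div_of_nonneg_right h2 ha.le) n.cast_nonneg) h3)
  have hsum : ∀ {C : Finset (X × ℕ)}, C.image Prod.fst ⊆ T →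
      ∑ k ∈ T, (fiberCard C k : ℝ) = C.card := fun hC => by
    exact_mod_cast sum_fiberCard _ hC
  calc ((symmDiff (rescale n A) (rescale n B)).card : ℝ)
      = ∑ k ∈ T, (fiberCard (symmDiff (rescale n A) (rescale n B)) k : ℝ) := (hsum hRT).symm
    _ ≤ ∑ k ∈ T, ((n * (fiberCard (symmDiff A B) k / A.card : ℝ)
        + n * ((symmDiff A B).card / A.card) * (fiberCard B k / B.card)) + 1) := by
        refine Finset.sum_le_sum fun k _ => ?_
        rw [fiberCard_symmDiff_rescale]
        exact (abs_sub_natDiv_le _ _ _ _).trans (by linarith [hterm k])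
    _ = 2 * n * ((symmDiff A B).card / A.card) + T.card := by
        rw [Finset.sum_add_distrib, Finset.sum_add_distrib, ← Finset.mul_sum, ← Finset.mul_sum,
          ← Finset.sum_div, ← Finset.sum_div, hsum hDT, hsum hBT, div_self hb.ne']
        simp only [Finset.sum_const, nsmul_eq_mul]
        ring
    _ ≤ _ := by linarith

theorem card_symmDiff_normalize_le (n : ℕ) (x y : X) {A B : Finset (X × ℕ)} (hA : A.Nonempty)
    (hB : B.Nonempty) :
    ((symmDiff (normalize n x A) (normalize n y B)).card : ℝ) ≤
      2 * n * ((symmDiff A B).card / A.card) +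
        2 * ((A.image Prod.fst).card + (B.image Prod.fst).card) := by
  have hsub : symmDiff (normalize n x A) (normalize n y B) ⊆
      symmDiff (rescale n A) (rescale n B) ∪
        (({x} ×ˢ Finset.Ico n (n + (n - (rescale n A).card))) ∪
          ({y} ×ˢ Finset.Ico n (n + (n - (rescale n B).card)))) := by
    intro p hp
    simp only [normalize, Finset.mem_symmDiff, Finset.mem_union] at hp ⊢
    tauto
  have hcard : (symmDiff (normalize n x A) (normalize n y B)).card ≤
      (symmDiff (rescale n A) (rescale n B)).card +
        ((n - (rescale n A).card) + (n - (rescale n B).card)) := by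
    refine (Finset.card_le_card hsub).trans ((Finset.card_union_le _ _).trans ?_)
    refine Nat.add_le_add_left ((Finset.card_union_le _ _).trans ?_) _
    simp
  have h1 := le_card_rescale n hA
  have h2 := le_card_rescale n hB
  have h3 : (symmDiff (normalize n x A) (normalize n y B)).card ≤
      (symmDiff (rescale n A) (rescale n B)).card +
        ((A.image Prod.fst).card + (B.image Prod.fst).card) := by omega
  have h4 : ((symmDiff (normalize n x A) (normalize n y B)).card : ℝ) ≤
      (symmDiff (rescale n A) (rescale n B)).card +
        ((A.image Prod.fst).card + (B.image Prod.fst).card) := by exact_mod_cast h3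
  linarith [card_symmDiff_rescale_le n hA hB]

/-- In a space of bounded geometry, the finite sets witnessing property A can be chosen to have
the same cardinality. -/
theorem HasPropertyA.exists_card_eq [MetricSpace X] (h : HasPropertyA X)
    (hX : HasBoundedGeometry X) {ε : ℝ} (hε : 0 < ε) {R : ℝ} (hR : 0 < R) :
    ∃ S : ℝ, 0 < S ∧ ∃ n : ℕ, 0 < n ∧ ∃ A : X → Finset (X × ℕ),
      (∀ x, (A x).card = n) ∧
      (∀ x, ∀ p ∈ A x, dist x p.1 < S) ∧
      (∀ x y, dist x y < R → ((symmDiff (A x) (A y)).card : ℝ) ≤ ε * n) := by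
  obtain ⟨S, hS, A, hne, hsupp, hvar⟩ := h (ε / 4) (by positivity) R hR
  obtain ⟨N, hN⟩ := hX S hS
  have hcard : ∀ x, ((A x).image Prod.fst).card ≤ N := fun x => by
    rw [← Nat.cast_le (α := ℕ∞), ← Set.encard_coe_eq_coe_finsetCard]
    refine (Set.encard_le_encard fun y hy => ?_).trans (hN x)
    obtain ⟨p, hp, rfl⟩ := Finset.mem_image.1 (Finset.mem_coe.1 hy)
    rw [Metric.mem_closedBall, dist_comm]
    exact (hsupp x p hp).le
  -- The variation is at most `2 * n * (ε / 4)` plus a rounding error `4 * N`; this `n` makes the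
  -- latter less than `ε * n / 2`.
  obtain ⟨n, hn⟩ := exists_nat_gt (8 * N / ε)
  have hn0 : (0 : ℝ) < n := lt_of_le_of_lt (by positivity) hn
  rw [div_lt_iff₀ hε] at hn
  refine ⟨S, hS, n, by exact_mod_cast hn0, fun x => normalize n x (A x),
    fun x => card_normalize n x _, fun x p hp => ?_, fun x y hxy => ?_⟩
  · rcases Finset.mem_union.1 hp with hp | hp
    · obtain ⟨q, hq, hqp⟩ := Finset.mem_image.1 (fst_mem_of_mem_rescale hp)
      exact hqp ▸ hsupp x q hq
    · rw [Finset.mem_singleton.1 (Finset.mem_product.1 hp).1, dist_self]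
      exact hS
  · have h1 := card_symmDiff_normalize_le n x y (hne x) (hne y)
    have h2 : (((A x).image Prod.fst).card : ℝ) ≤ N := by exact_mod_cast hcard x
    have h3 : (((A y).image Prod.fst).card : ℝ) ≤ N := by exact_mod_cast hcard y
    have h4 := mul_le_mul_of_nonneg_left (hvar x y hxy).le (show (0 : ℝ) ≤ 2 * n by positivity)
    linarith

end Normalize

/-! ### From the space and a stabilizer to the group -/

/-- A base point in only one of `s`, `t` contributes a full fibre of size `n`, a common one at most
`c`. -/
theorem card_symmDiff_sigma_le {α β : Type*} [DecidableEq α] [DecidableEq β] {s t : Finset α} {u v : α → Finset β} {n : ℕ}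
    {c : ℝ} (hu : ∀ a, (u a).card = n) (hv : ∀ a, (v a).card = n)
    (huv : ∀ a ∈ s, a ∈ t → ((symmDiff (u a) (v a)).card : ℝ) ≤ c) (hc : 0 ≤ c) :
    ((symmDiff (s.sigma u) (t.sigma v)).card : ℝ) ≤ (symmDiff s t).card * n + s.card * c := by
  have hsub : symmDiff (s.sigma u) (t.sigma v) ⊆
      ((s \ t).sigma u ∪ (t \ s).sigma v) ∪ (s ∩ t).sigma fun a => symmDiff (u a) (v a) := by
    rintro ⟨a, b⟩ h
    simp only [Finset.mem_symmDiff, Finset.mem_sigma, Finset.mem_union, Finset.mem_sdiff,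
      Finset.mem_inter] at h ⊢
    tauto
  have hcard := (Finset.card_le_card hsub).trans ((Finset.card_union_le _ _).trans
    (Nat.add_le_add_right (Finset.card_union_le _ _) _))
  simp only [Finset.card_sigma, hu, hv, Finset.sum_const, smul_eq_mul] at hcard
  have hst : (symmDiff s t).card = (s \ t).card + (t \ s).card :=
    Finset.card_union_of_disjoint disjoint_sdiff_sdiff
  have hsum : ∑ a ∈ s ∩ t, ((symmDiff (u a) (v a)).card : ℝ) ≤ s.card * c := by
    calc _ ≤ ∑ a ∈ s ∩ t, c := Finset.sum_le_sum fun a ha =>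
          huv a (Finset.mem_inter.1 ha).1 (Finset.mem_inter.1 ha).2
      _ = (s ∩ t).card * c := by simp
      _ ≤ _ := by
          gcongr
          exact Finset.inter_subset_left
  have hcard' : ((symmDiff (s.sigma u) (t.sigma v)).card : ℝ) ≤
      (s \ t).card * n + (t \ s).card * n + ∑ a ∈ s ∩ t, ((symmDiff (u a) (v a)).card : ℝ) := by
    exact_mod_cast hcard
  rw [hst]
  push_cast
  linarith

open scoped Classical in
/-- A finitely generated group acting cocompactly on a space of bounded geometry with property A
has property A as soon as one point stabilizer does. -/
theorem groupHasPropertyA_of_stabilizer {G X : Type*} [Group G] [Group.FG G] [MetricSpace X]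
    [MulAction G X] [IsIsometricSMul G X]
    (hcocompact : IsCocompactAction G X)
    (hgeometry : HasBoundedGeometry X)
    (hX : HasPropertyA X)
    (x₀ : X)
    (hstab : GroupHasPropertyA (MulAction.stabilizer G x₀)) :
    GroupHasPropertyA G := by
  obtain ⟨m, hm⟩ := exists_isProperLeftInvariant G
  refine ⟨m, hm, ?_⟩
  have dist_mul : ∀ g a b : G, dist (g * a) (g * b) = dist a b := hm.dist_mul_left
  set H := MulAction.stabilizer G x₀ with hH
  have hmH : IsProperLeftInvariant (inferInstance : MetricSpace H) :=
    ⟨fun g a b => hm.dist_mul_left g a b,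
      fun r => (hm.finite_ball r).preimage Subtype.val_injective.injOn⟩
  have hHA : HasPropertyA H := by
    obtain ⟨m', hm', hA⟩ := hstab
    exact hasPropertyA_of_isProperLeftInvariant m' _ hm' hmH hA
  obtain ⟨s, D, hs⟩ : ∃ (s : X → G) (D : ℝ), ∀ z, dist z (s z • x₀) ≤ D := by
    obtain ⟨K, hK, hcover⟩ := hcocompact
    obtain ⟨D, hD⟩ := (Metric.isBounded_iff_subset_closedBall x₀).1 hK.isBounded
    choose s k hk hsk using hcover
    refine ⟨s, D, fun z => ?_⟩
    have h : dist (s z • k z) (s z • x₀) ≤ D := by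
      rw [dist_smul]
      exact hD (hk z)
    rwa [hsk] at h
  obtain ⟨t, ht⟩ : ∃ t : X → G, ∀ g : G, t (g • x₀) • x₀ = g • x₀ := by
    refine ⟨fun w => if h : ∃ g : G, g • x₀ = w then h.choose else 1, fun g => ?_⟩
    have h : ∃ g' : G, g' • x₀ = g • x₀ := ⟨g, rfl⟩
    simp only [h, dif_pos]
    exact h.choose_spec
  -- The point `s z * q z g` of the coset `s z * H` stands in for a projection of `g`: both `s z`
  -- and `g * t ((g⁻¹ * s z) • x₀)` send `x₀` to `s z • x₀`.
  let q : X → G → H := fun z g => ⟨(s z)⁻¹ * (g * t ((g⁻¹ * s z) • x₀)), by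
    rw [hH, MulAction.mem_stabilizer_iff, mul_smul, mul_smul, ht, ← mul_smul, ← mul_smul]
    simp⟩
  have hq : ∀ z g, s z * q z g = g * t ((g⁻¹ * s z) • x₀) := fun z g =>
    mul_inv_cancel_left _ _
  have : Countable X := hgeometry.countable x₀
  obtain ⟨code, hcode⟩ := exists_injective_nat (X × ℕ × ℕ)
  -- The second coordinate records all labels, so pieces lying over different points of `X × ℕ` stay
  -- disjoint in `G × ℕ`.
  let Φ : (Σ _ : X × ℕ, H × ℕ) → G × ℕ := fun p =>
    (s p.1.1 * p.2.1, code (p.1.1, p.1.2, p.2.2))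
  have hΦ : Function.Injective Φ := by
    rintro ⟨⟨z, i⟩, k, j⟩ ⟨⟨z', i'⟩, k', j'⟩ h
    obtain ⟨h1, h2⟩ := Prod.mk.inj h
    have h3 := hcode h2
    simp only [Prod.mk.injEq] at h3
    obtain ⟨rfl, rfl, rfl⟩ := h3
    have := Subtype.val_injective (mul_left_cancel h1)
    simp only at this
    rw [this]
  intro ε hε R hR
  obtain ⟨R₁, hR₁, hdist⟩ : ∃ R₁ : ℝ, 0 < R₁ ∧
      ∀ g g' : G, dist g g' < R → dist (g • x₀) (g' • x₀) < R₁ := by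
    obtain ⟨b, hb⟩ := ((hm.finite_ball R).image fun g => dist x₀ (g • x₀)).bddAbove
    refine ⟨max b 0 + 1, by positivity, fun g g' h => ?_⟩
    rw [← dist_mul g⁻¹, inv_mul_cancel] at h
    rw [← dist_smul g⁻¹, inv_smul_smul, ← mul_smul]
    have := hb ⟨g⁻¹ * g', h.le, rfl⟩
    exact (this.trans (le_max_left b 0)).trans_lt (lt_add_one _)
  obtain ⟨S, hS, A, hAne, hAsupp, hAvar⟩ := hX (ε / 2) (by positivity) R₁ hR₁
  -- Only finitely many `w` lie within `S + D` of `x₀`, which bounds the distance from `g` to its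
  -- projections uniformly.
  obtain ⟨C, hC0, hC⟩ : ∃ C : ℝ, 0 ≤ C ∧ ∀ w, dist x₀ w ≤ S + D → dist 1 (t w) ≤ C := by
    obtain ⟨b, hb⟩ :=
      ((hgeometry.finite_closedBall x₀ (S + D)).image fun w => dist 1 (t w)).bddAbove
    refine ⟨max b 0, le_max_right _ _, fun w hw => le_max_of_le_left (hb ⟨w, ?_, rfl⟩)⟩
    rwa [Metric.mem_closedBall, dist_comm]
  have hqC : ∀ g : G, ∀ p ∈ A (g • x₀), dist g (s p.1 * q p.1 g) ≤ C := by
    intro g p hp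
    rw [hq]
    nth_rewrite 1 [← mul_one g]
    rw [dist_mul]
    apply hC
    rw [mul_smul, ← dist_smul g, smul_inv_smul]
    exact (dist_triangle _ _ _).trans (add_le_add (hAsupp _ p hp).le (hs _))
  -- If `dist g g' < R`, the projections of `g` and `g'` to one coset are less than `C + R + C`
  -- apart, through `g` and `g'`.
  obtain ⟨S', hS', n, hn, B, hBcard, hBsupp, hBvar⟩ :=
    hHA.exists_card_eq hmH.hasBoundedGeometry (half_pos hε) (R := C + R + C) (by positivity)
  let F : G → Finset (Σ _ : X × ℕ, H × ℕ) := fun g =>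
    (A (g • x₀)).sigma fun p => B (q p.1 g)
  have hFcard : ∀ g, (F g).card = (A (g • x₀)).card * n := fun g => by
    simp [F, Finset.card_sigma, hBcard]
  refine ⟨C + S', by positivity, fun g => (F g).image Φ, fun g => ?_, fun g p hp => ?_,
    fun g g' hgg' => ?_⟩
  · rw [Finset.image_nonempty, ← Finset.card_pos, hFcard]
    exact Nat.mul_pos (hAne _).card_pos hn
  · obtain ⟨⟨a, k⟩, hak, rfl⟩ := Finset.mem_image.1 hp
    obtain ⟨ha, hk⟩ := Finset.mem_sigma.1 hak
    have h1 := hqC g a ha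
    have h2 : dist (s a.1 * (q a.1 g : G)) (s a.1 * (k.1 : G)) < S' := by
      rw [dist_mul]
      exact hBsupp _ k hk
    exact (dist_triangle _ _ _).trans_lt (add_lt_add_of_le_of_lt h1 h2)
  · have hA0 : (0 : ℝ) < (A (g • x₀)).card := by exact_mod_cast (hAne _).card_pos
    have hn0 : (0 : ℝ) < n := by exact_mod_cast hn
    have hA := hAvar _ _ (hdist g g' hgg')
    rw [div_lt_iff₀ hA0] at hA
    have hB : ∀ a ∈ A (g • x₀), a ∈ A (g' • x₀) →
        ((symmDiff (B (q a.1 g)) (B (q a.1 g'))).card : ℝ) ≤ ε / 2 * n := by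
      intro a ha ha'
      convert hBvar (q a.1 g) (q a.1 g') ?_
      have h1 := hqC g a ha
      have h2 := hqC g' a ha'
      rw [dist_comm] at h1
      have h3 := dist_triangle4 (s a.1 * (q a.1 g : G)) g g' (s a.1 * (q a.1 g' : G))
      rw [dist_mul] at h3
      rw [Subtype.dist_eq]
      linarith
    have hF : ((symmDiff (F g) (F g')).card : ℝ) ≤
        (symmDiff (A (g • x₀)) (A (g' • x₀))).card * n + (A (g • x₀)).card * (ε / 2 * n) :=
      card_symmDiff_sigma_le (fun a => hBcard (q a.1 g)) (fun a => hBcard (q a.1 g')) hB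
        (by positivity)
    -- Half of `ε` pays for the change of `A`, half for the change of the sets `B` over common
    -- points.
    rw [← Finset.image_symmDiff _ _ hΦ, Finset.card_image_of_injective _ hΦ,
      Finset.card_image_of_injective _ hΦ, hFcard, Nat.cast_mul, div_lt_iff₀ (by positivity)]
    refine hF.trans_lt ?_
    linarith [mul_lt_mul_of_pos_right hA hn0]

end CoarseGeometry

theorem mainTheorem5 {G X : Type*} [Group G] [Group.FG G] [MetricSpace X]
    [MulAction G X] [IsIsometricSMul G X]
    (hcocompact : CoarseGeometry.IsCocompactAction G X)
    (hdiscrete : CoarseGeometry.IsUniformlyDiscrete X)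
    (hgeometry : CoarseGeometry.HasBoundedGeometry X)
    (hX : CoarseGeometry.HasPropertyA X)
    (x₀ : X)
    (hstab : CoarseGeometry.GroupHasPropertyA (MulAction.stabilizer G x₀)) :
    CoarseGeometry.GroupHasPropertyA G := by
  exact CoarseGeometry.groupHasPropertyA_of_stabilizer hcocompact hgeometry hX x₀ hstab
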